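/- Let $\Delta\ge 3$ be an integer and $\beta\ge 0$ a real number. There are constants $\alpha=\alpha(\Delta,\beta)>0$ and $c=c(\Delta,\beta)>0$ such that the following holds for every finite simple graph $G=(V,E)$ of maximum degree at most $\Delta$, with $n=|V|$, every integer $k$ with $0<k\le n/2$, and every $U\subset V$ with $0<k-|U|\le\alpha n$. Let $\Omega_k^U$ be the set of spin configurations $\sigma:V\to\{+1,-1\}$ with exactly $k$ vertices of spin $+1$ and with $\sigma(u)=+1$ for all $u\in U$. Let $\hat\mu^U_{\beta,k}$ be the probability measure on $\Omega_k^U$ with $\hat\mu^U_{\beta,k}(\sigma)\propto e^{\beta m_G(\sigma)}$, where $m_G(\sigma)$ is the number of edges of $G$ whose two endpoints have the same spin. Let $\mathcal P^U_{\beta,k}$ be the plus-pinned down-up walk on $\Omega_k^U$: from the state $\sigma$, pick $v\in\sigma^{-1}(+1)\setminus U$ uniformly at random, set $W=\sigma^{-1}(+1)\setminus\{v\}$, and draw the next state from $\hat\mu^{W}_{\beta,k}$. Then the spectral gap of $\mathcal P^U_{\beta,k}$ is at least $c/k$. Here the spectral gap of a transition matrix $P$ that is reversible with respect to a distribution $\pi$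 on a finite set $\Omega$ is the largest $\gamma$ such that for all $f:\Omega\to\mathbb R$ $$\gamma\,\mathrm{Var}_\pi(f)\le \tfrac12\sum_{x,y\in\Omega}(f(x)-f(y))^2P(x,y)\pi(x).$$ -/

import Mathlib

namespace FixedMagIsing

/-! ### Reversible chains on a finite state space -/

/-- The variance `Var_π(f)` of `f` with respect to the distribution `π`. -/
noncomputable def variance {Ω : Type*} [Fintype Ω] (π : Ω → ℝ) (f : Ω → ℝ) : ℝ :=
  ∑ x, π x * (f x - ∑ y, π y * f y) ^ 2

/-- The Dirichlet form `𝓔_P(f, g)` of the transition matrix `P` with reversible distribution `π`. -/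
noncomputable def dirichletForm {Ω : Type*} [Fintype Ω] (P : Matrix Ω Ω ℝ) (π : Ω → ℝ)
    (f g : Ω → ℝ) : ℝ :=
  (1 / 2) * ∑ x, ∑ y, (f x - f y) * (g x - g y) * P x y * π x

/-- The spectral gap (Poincaré constant): the largest `γ` such that
`γ * Var_π(f) ≤ 𝓔_P(f, f)` for all `f : Ω → ℝ`.  If `Ω` has at least two points and `π` charges
them all, the set below is nonempty, closed and bounded above, so the supremum is its maximum. -/
noncomputable def spectralGap {Ω : Type*} [Fintype Ω] (P : Matrix Ω Ω ℝ) (π : Ω → ℝ) : ℝ :=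
  sSup {γ : ℝ | ∀ f : Ω → ℝ, γ * variance π f ≤ dirichletForm P π f f}

/-! ### The fixed-magnetization Ising model with plus pinnings

A spin configuration `σ : V → {+1, -1}` is identified with the set `S = σ⁻¹(+1)` of its plus
vertices. -/

/-- The number `m_G(σ)` of monochromatic edges. -/
def monoEdges {V : Type*} [Fintype V] [DecidableEq V] (G : SimpleGraph V) [DecidableRel G.Adj]
    (S : Finset V) : ℕ :=
  (G.edgeFinset.filter fun e => ∀ u ∈ e, ∀ w ∈ e, (u ∈ S ↔ w ∈ S)).card

/-- The state space `Ω_k^U`: configurations with exactly `k` plus vertices in which every vertex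
of `U` has spin `+1`. -/
abbrev Config (V : Type*) [Fintype V] [DecidableEq V] (k : ℕ) (U : Finset V) : Type _ :=
  {S : Finset V // S.card = k ∧ U ⊆ S}

/-- The partition function `∑_{σ ∈ Ω_k^U} exp(β m_G(σ))`. -/
noncomputable def partitionFn {V : Type*} [Fintype V] [DecidableEq V] (G : SimpleGraph V)
    [DecidableRel G.Adj] (β : ℝ) (k : ℕ) (U : Finset V) : ℝ :=
  ∑ S : Config V k U, Real.exp (β * monoEdges G S.1)

/-- The fixed-magnetization Ising model under the plus pinning on `U`, as a mass function on all
configurations, supported on `Ω_k^U`. -/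
noncomputable def gibbs {V : Type*} [Fintype V] [DecidableEq V] (G : SimpleGraph V)
    [DecidableRel G.Adj] (β : ℝ) (k : ℕ) (U : Finset V) (S : Finset V) : ℝ :=
  if S.card = k ∧ U ⊆ S then Real.exp (β * monoEdges G S) / partitionFn G β k U else 0

/-- The transition matrix of the pinned down-up walk on `Ω_k^U`: from `X`, pick `v ∈ X \ U`
uniformly at random, and draw the next state from the fixed-magnetization Ising model under the
plus pinning on `X \ {v}`. -/
noncomputable def downUpWalk {V : Type*} [Fintype V] [DecidableEq V] (G : SimpleGraph V)
    [DecidableRel G.Adj] (β : ℝ) (k : ℕ) (U : Finset V) :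
    Matrix (Config V k U) (Config V k U) ℝ :=
  fun X Y => ∑ v ∈ X.1 \ U, (1 / ((X.1 \ U).card : ℝ)) * gibbs G β k (X.1.erase v) Y.1

end FixedMagIsing

/-! The proof is a path coupling argument in dual form. Write $r=k-|U|$ and let two configurations
$A\cup\{x\}$, $A\cup\{y\}$ be one swap apart. With probability $1/r$ the down step removes $x$ from
one and $y$ from the other, and both walks continue from $A$. Otherwise the same $v\in A\setminus U$
is removed, and the two up steps add a vertex with rates that differ only at the at most $2\Delta$
neighbours of $x$ and $y$. Each rate lies between $e^{-\beta\Delta}$ and $e^{\beta\Delta}$ and at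
least $n/2$ vertices are available, so the discrepancy grows by a factor of at most $1+C/n$
(`abs_upAverage_sub_le`). If $r\le n/(2C)$, the swap-Lipschitz seminorm contracts by
$(1-1/r)(1+C/n)\le 1-1/(2r)$ (`downUpWalk_contraction`).

By reversibility, such a contraction rules out the eigenvalues that would violate the Poincaré
inequality (`poincare_of_contraction`). The gap is therefore at least $1/(2r)\ge 1/(2k)$. -/

namespace FixedMagIsing

/-! ### From Lipschitz contraction to a Poincaré inequality -/

section Reversible

variable {Ω : Type*} [Fintype Ω]

/-- The Dirichlet form of a reversible chain as the quadratic form of `1 - P`. -/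
lemma dirichletForm_eq {P : Matrix Ω Ω ℝ} {π : Ω → ℝ} (hrow : ∀ x, ∑ y, P x y = 1)
    (hrev : ∀ x y, π x * P x y = π y * P y x) (f : Ω → ℝ) :
    dirichletForm P π f f = ∑ x, π x * f x * (f x - ∑ y, P x y * f y) := by
  have h1 : ∑ x, ∑ y, (f x - f y) * (f x - f y) * P x y * π x
      = ∑ x, ∑ y, π x * P x y * (f x * f x - f x * f y)
        + ∑ x, ∑ y, π x * P x y * (f y * f y - f x * f y) := by
    rw [← Finset.sum_add_distrib]
    refine Finset.sum_congr rfl fun x _ => ?_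
    rw [← Finset.sum_add_distrib]
    exact Finset.sum_congr rfl fun y _ => by ring
  have h2 : ∑ x, ∑ y, π x * P x y * (f y * f y - f x * f y)
      = ∑ x, ∑ y, π x * P x y * (f x * f x - f x * f y) := by
    rw [Finset.sum_comm]
    refine Finset.sum_congr rfl fun x _ => Finset.sum_congr rfl fun y _ => ?_
    rw [hrev y x]; ring
  rw [dirichletForm, h1, h2, ← two_mul, ← mul_assoc, one_div, inv_mul_cancel₀ two_ne_zero, one_mul]
  refine Finset.sum_congr rfl fun x _ => ?_
  calc ∑ y, π x * P x y * (f x * f x - f x * f y)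
      = π x * f x * (f x * ∑ y, P x y - ∑ y, P x y * f y) := by
        rw [Finset.mul_sum, ← Finset.sum_sub_distrib, Finset.mul_sum]
        exact Finset.sum_congr rfl fun y _ => by ring
    _ = _ := by rw [hrow, mul_one]

lemma variance_eq {π : Ω → ℝ} (hsum : ∑ x, π x = 1) (f : Ω → ℝ) :
    variance π f = ∑ x, π x * f x * (f x - ∑ y, π y * f y) := by
  set m := ∑ y, π y * f y with hm
  have h : ∑ x, π x * m * (f x - m) = 0 := by
    have : ∑ x, π x * m * (f x - m) = m * (∑ x, π x * f x - m * ∑ x, π x) := by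
      rw [Finset.mul_sum, ← Finset.sum_sub_distrib, Finset.mul_sum]
      exact Finset.sum_congr rfl fun y _ => by ring
    rw [this, hsum, ← hm]; ring
  rw [variance, ← sub_zero (∑ x, π x * f x * (f x - m)), ← h, ← Finset.sum_sub_distrib]
  exact Finset.sum_congr rfl fun y _ => by ring

/-- An eigenfunction of the operator `f ↦ (1 - κ) f - P f + κ π(f)` cannot have a negative
eigenvalue if `P` contracts Lipschitz seminorms by `1 - κ`. -/
lemma eq_zero_of_contraction {P : Matrix Ω Ω ℝ} {π : Ω → ℝ} (hsum : ∑ x, π x = 1)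
    (hrow : ∀ x, ∑ y, P x y = 1) {adj : Ω → Ω → Prop}
    (hconn : ∀ f : Ω → ℝ, (∀ x y, adj x y → f x = f y) → ∀ x y, f x = f y) {κ : ℝ}
    (hcontr : ∀ (f : Ω → ℝ) (L : ℝ), (∀ x y, adj x y → |f x - f y| ≤ L) →
      ∀ x y, adj x y → |∑ z, P x z * f z - ∑ z, P y z * f z| ≤ (1 - κ) * L)
    {f : Ω → ℝ} {l : ℝ} (hl : l < 0)
    (hf : ∀ x, (f x - ∑ y, P x y * f y) - κ * (f x - ∑ y, π y * f y) = l * f x) :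
    ∀ x, f x = 0 := by
  classical
  -- At an adjacent pair maximizing $|f(x)-f(y)|$, the eigenvalue equation turns the difference of
  -- $Pf$ into $(1-\kappa-l)(f(x)-f(y))$. For $l<0$ this exceeds what the contraction allows, unless
  -- the maximum is zero.
  have hconst : ∀ x y, f x = f y := by
    refine hconn f ?_
    by_contra! hne
    obtain ⟨a, b, hab, hne⟩ := hne
    obtain ⟨⟨x, y⟩, hxy, hmax⟩ := Finset.exists_max_image
      (Finset.univ.filter fun p : Ω × Ω => adj p.1 p.2) (fun p => |f p.1 - f p.2|)
      ⟨(a, b), by simpa using hab⟩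
    have hxy' : adj x y := by simpa using hxy
    have hpos : 0 < |f x - f y| :=
      (abs_pos.2 (sub_ne_zero.2 hne)).trans_le (hmax (a, b) (by simpa using hab))
    have hc := hcontr f |f x - f y| (fun u v huv => hmax (u, v) (by simpa using huv)) x y hxy'
    have heq : ∑ z, P x z * f z - ∑ z, P y z * f z = (1 - κ - l) * (f x - f y) := by
      linarith [hf x, hf y]
    rw [heq, abs_mul] at hc
    have := le_of_mul_le_mul_right hc hpos
    linarith [le_abs_self (1 - κ - l)]
  intro x
  have h1 : ∑ y, P x y * f y = f x := by
    rw [Finset.sum_congr rfl fun y _ => by rw [hconst y x], ← Finset.sum_mul, hrow, one_mul]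
  have h2 : ∑ y, π y * f y = f x := by
    rw [Finset.sum_congr rfl fun y _ => by rw [hconst y x], ← Finset.sum_mul, hsum, one_mul]
  have := hf x
  rw [h1, h2, sub_self, mul_zero, sub_zero] at this
  exact (mul_eq_zero.1 this.symm).resolve_left hl.ne

/-- A reversible chain contracting the Lipschitz seminorm of a connected graph by `1 - κ` satisfies
the Poincaré inequality with constant `κ`. -/
lemma poincare_of_contraction {P : Matrix Ω Ω ℝ} {π : Ω → ℝ} (hpos : ∀ x, 0 < π x)
    (hsum : ∑ x, π x = 1) (hrow : ∀ x, ∑ y, P x y = 1)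
    (hrev : ∀ x y, π x * P x y = π y * P y x) {adj : Ω → Ω → Prop}
    (hconn : ∀ f : Ω → ℝ, (∀ x y, adj x y → f x = f y) → ∀ x y, f x = f y) {κ : ℝ}
    (hcontr : ∀ (f : Ω → ℝ) (L : ℝ), (∀ x y, adj x y → |f x - f y| ≤ L) →
      ∀ x y, adj x y → |∑ z, P x z * f z - ∑ z, P y z * f z| ≤ (1 - κ) * L)
    (f : Ω → ℝ) : κ * variance π f ≤ dirichletForm P π f f := by
  classical
  set s : Ω → ℝ := fun x => √(π x) with hs
  have hs0 : ∀ x, 0 < s x := fun x => Real.sqrt_pos.2 (hpos x)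
  have hss : ∀ x, s x * s x = π x := fun x => Real.mul_self_sqrt (hpos x).le
  -- Conjugating $(1-\kappa)I-P+\kappa\,\mathbf 1\pi^{T}$ by $\sqrt\pi$ gives a matrix that is
  -- symmetric by reversibility. Its quadratic form at $\sqrt\pi f$ is $\mathcal
  -- E(f,f)-\kappa\,\mathrm{Var}_\pi(f)$.
  let N : Matrix Ω Ω ℝ := fun x y =>
    (if x = y then 1 - κ else 0) - s x * P x y / s y + κ * (s x * s y)
  have hN : ∀ (g : Ω → ℝ) (x : Ω), (N.mulVec fun y => s y * g y) x
      = s x * ((g x - ∑ y, P x y * g y) - κ * (g x - ∑ y, π y * g y)) := by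
    intro g x
    have : (N.mulVec fun y => s y * g y) x = ∑ y, ((if x = y then (1 - κ) * (s y * g y) else 0)
        - s x * (P x y * g y) + s x * κ * (π y * g y)) := by
      refine Finset.sum_congr rfl fun y _ => ?_
      have := (hs0 y).ne'
      simp only [N, ← hss y]
      split_ifs
      · field_simp
      · field_simp
        ring
    rw [this, Finset.sum_add_distrib, Finset.sum_sub_distrib, ← Finset.mul_sum, ← Finset.mul_sum,
      Finset.sum_ite_eq, if_pos (Finset.mem_univ x)]
    ring
  have hherm : N.IsHermitian := by
    ext x y
    have h1 := (hs0 x).ne'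
    have h2 := (hs0 y).ne'
    have h3 : s y * P y x / s x = s x * P x y / s y := by
      rw [div_eq_div_iff h1 h2]
      have := hrev x y
      rw [← hss, ← hss] at this
      linarith
    change N y x = N x y
    simp only [N, h3, eq_comm (a := y) (b := x)]
    ring
  have hpsd : N.PosSemidef := by
    rw [hherm.posSemidef_iff_eigenvalues_nonneg]
    intro i
    by_contra hneg
    have hneg : hherm.eigenvalues i < 0 := lt_of_not_ge hneg
    set e : Ω → ℝ := (hherm.eigenvectorBasis i).ofLp with he
    have hev := hherm.mulVec_eigenvectorBasis i
    rw [← he] at hev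
    have hg : (fun y => s y * (e y / s y)) = e :=
      funext fun y => mul_div_cancel₀ _ (hs0 y).ne'
    have hzero := eq_zero_of_contraction hsum hrow hconn hcontr (f := fun y => e y / s y) hneg
      (fun x => by
        have h := hN (fun y => e y / s y) x
        rw [hg, hev] at h
        refine mul_left_cancel₀ (hs0 x).ne' (h.symm.trans ?_)
        have := (hs0 x).ne'
        simp only [Pi.smul_apply, smul_eq_mul]
        field_simp)
    apply hherm.eigenvectorBasis.orthonormal.ne_zero i
    ext x
    have := hzero x
    rw [div_eq_zero_iff] at this
    exact this.resolve_right (hs0 x).ne'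
  have hq := hpsd.dotProduct_mulVec_nonneg (fun y => s y * f y)
  rw [dirichletForm_eq hrow hrev, variance_eq hsum, ← sub_nonneg, Finset.mul_sum,
    ← Finset.sum_sub_distrib]
  refine hq.trans_eq (Finset.sum_congr rfl fun x _ => ?_)
  rw [hN, ← hss x]
  simp only [Pi.star_apply, star_trivial]
  ring

/-- A Poincaré inequality bounds the spectral gap from below. -/
lemma le_spectralGap [Nontrivial Ω] {P : Matrix Ω Ω ℝ} {π : Ω → ℝ} (hpos : ∀ x, 0 < π x) {κ : ℝ}
    (h : ∀ f, κ * variance π f ≤ dirichletForm P π f f) : κ ≤ spectralGap P π := by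
  classical
  obtain ⟨a, b, hab⟩ := exists_pair_ne Ω
  let f : Ω → ℝ := fun x => if x = a then 1 else 0
  have hvar : 0 < variance π f := by
    have hnn : ∀ x ∈ Finset.univ, 0 ≤ π x * (f x - ∑ y, π y * f y) ^ 2 :=
      fun x _ => mul_nonneg (hpos x).le (sq_nonneg _)
    refine (Finset.sum_nonneg hnn).lt_of_ne fun h0 => ?_
    have hz := (Finset.sum_eq_zero_iff_of_nonneg hnn).1 h0.symm
    have hz' : ∀ x, f x = ∑ y, π y * f y := fun x => by
      have := (mul_eq_zero.1 (hz x (Finset.mem_univ x))).resolve_left (hpos x).ne'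
      exact sub_eq_zero.1 (pow_eq_zero_iff two_ne_zero |>.1 this)
    have : f a = f b := (hz' a).trans (hz' b).symm
    simp [f, hab.symm] at this
  -- A real `sSup` is only meaningful for a set bounded above; one function of positive variance
  -- supplies the bound.
  refine le_csSup ⟨dirichletForm P π f f / variance π f, fun γ hγ => ?_⟩ h
  exact (le_div_iff₀ hvar).2 (hγ f)

end Reversible

/-! ### Perturbation of weighted averages -/

/-- Comparison of two weighted averages whose weights and values are close to each other. -/
lemma abs_average_sub_average_le {ι : Type*} (T : Finset ι) {a a' g g' : ι → ℝ}
    {b b' c L D M z : ℝ} (ha : ∀ i ∈ T, 0 ≤ a i) (ha' : ∀ i ∈ T, 0 ≤ a' i) (hb : 0 ≤ b)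
    (hb' : 0 < b') (hL : 0 ≤ L) (hg : ∀ i ∈ T, |g i - g' i| ≤ L) (hc : ∀ i ∈ T, |g' i - c| ≤ L)
    (hD : ∑ i ∈ T, |a i - a' i| ≤ D) (hM : |b - b'| ≤ M) (hz : 0 < z) (hZ : z ≤ ∑ i ∈ T, a i + b) :
    |(∑ i ∈ T, a i * g i + b * c) / (∑ i ∈ T, a i + b)
      - (∑ i ∈ T, a' i * g' i + b' * c) / (∑ i ∈ T, a' i + b')| ≤ (1 + (2 * D + M) / z) * L := by
  set Z := ∑ i ∈ T, a i + b with hZdef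
  set Z' := ∑ i ∈ T, a' i + b' with hZdef'
  have hS' : 0 ≤ ∑ i ∈ T, a' i := Finset.sum_nonneg ha'
  have hZ0 : 0 < Z := hz.trans_le hZ
  have hZ0' : 0 < Z' := by positivity
  have hZZ : |Z' - Z| ≤ D + M := by
    have : Z' - Z = -(∑ i ∈ T, (a i - a' i)) - (b - b') := by
      rw [Finset.sum_sub_distrib]; ring
    rw [this]
    refine (abs_sub _ _).trans (add_le_add ?_ hM)
    rw [abs_neg]
    exact (Finset.abs_sum_le_sum_abs _ _).trans hD
  have hD0 : 0 ≤ D := (Finset.sum_nonneg fun i _ => abs_nonneg _).trans hD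
  have hM0 : 0 ≤ M := (abs_nonneg _).trans hM
  -- Measuring values relative to the shared value $c$ removes the exceptional entry. The three
  -- terms are the changes of values, weights and normalization, and contribute $1$, $D/z$ and
  -- $(D+M)/z$ times $L$.
  have key : (∑ i ∈ T, a i * g i + b * c) / Z - (∑ i ∈ T, a' i * g' i + b' * c) / Z'
      = ∑ i ∈ T, (a i / Z * (g i - g' i) + (a i - a' i) / Z * (g' i - c)
        + a' i / Z' * ((Z' - Z) / Z) * (g' i - c)) := by
    have e1 : (∑ i ∈ T, a i * g i + b * c) / Z = c + ∑ i ∈ T, a i / Z * (g i - c) := by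
      have : ∑ i ∈ T, a i / Z * (g i - c) = (∑ i ∈ T, a i * g i - (∑ i ∈ T, a i) * c) / Z := by
        rw [Finset.sum_mul, ← Finset.sum_sub_distrib, Finset.sum_div]
        exact Finset.sum_congr rfl fun i _ => by ring
      rw [this, eq_comm, ← sub_eq_zero]
      field_simp
      rw [hZdef]; ring
    have e2 : (∑ i ∈ T, a' i * g' i + b' * c) / Z' = c + ∑ i ∈ T, a' i / Z' * (g' i - c) := by
      have : ∑ i ∈ T, a' i / Z' * (g' i - c)
          = (∑ i ∈ T, a' i * g' i - (∑ i ∈ T, a' i) * c) / Z' := by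
        rw [Finset.sum_mul, ← Finset.sum_sub_distrib, Finset.sum_div]
        exact Finset.sum_congr rfl fun i _ => by ring
      rw [this, eq_comm, ← sub_eq_zero]
      field_simp
      rw [hZdef']; ring
    rw [e1, e2, add_sub_add_left_eq_sub, ← Finset.sum_sub_distrib]
    refine Finset.sum_congr rfl fun i _ => ?_
    field_simp
    ring
  rw [key]
  calc _ ≤ ∑ i ∈ T, (a i / Z * L + |a i - a' i| / Z * L + a' i / Z' * ((D + M) / Z) * L) := by
        refine (Finset.abs_sum_le_sum_abs _ _).trans (Finset.sum_le_sum fun i hi => ?_)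
        have h1 := ha i hi
        have h2 := ha' i hi
        refine (abs_add_le _ _).trans (add_le_add ((abs_add_le _ _).trans (add_le_add ?_ ?_)) ?_)
        · rw [abs_mul, abs_of_nonneg (div_nonneg h1 hZ0.le)]
          exact mul_le_mul_of_nonneg_left (hg i hi) (by positivity)
        · rw [abs_mul, abs_div, abs_of_pos hZ0]
          exact mul_le_mul_of_nonneg_left (hc i hi) (by positivity)
        · rw [abs_mul, abs_mul, abs_div (Z' - Z), abs_of_pos hZ0,
            abs_of_nonneg (div_nonneg h2 hZ0'.le)]
          gcongr
          exact hc i hi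
    _ = ((∑ i ∈ T, a i) / Z + ((∑ i ∈ T, |a i - a' i|)
          + (∑ i ∈ T, a' i) / Z' * (D + M)) / Z) * L := by
        simp only [Finset.sum_add_distrib, ← Finset.sum_mul, ← Finset.sum_div]
        ring
    _ ≤ (1 + (D + 1 * (D + M)) / z) * L := by
        gcongr
        · exact (div_le_one hZ0).2 (by linarith)
        · exact (div_le_one hZ0').2 (by linarith)
    _ = _ := by ring_nf

lemma mono_insert_iff {V : Type*} [DecidableEq V] {e : Sym2 V} {x : V} (hx : x ∉ e) (S : Finset V) :
    (∀ u ∈ e, ∀ w ∈ e, (u ∈ insert x S ↔ w ∈ insert x S)) ↔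
      ∀ u ∈ e, ∀ w ∈ e, (u ∈ S ↔ w ∈ S) := by
  refine forall₂_congr fun u hu => forall₂_congr fun w hw => ?_
  have h1 : u ≠ x := fun h => hx (h ▸ hu)
  have h2 : w ≠ x := fun h => hx (h ▸ hw)
  simp [h1, h2]

/-! ### Local rates and the up step -/

section Walk

variable {V : Type*} [Fintype V] [DecidableEq V] (G : SimpleGraph V) [DecidableRel G.Adj]

/-- The change of the number of monochromatic edges when `w` becomes a plus vertex. -/
noncomputable def monoIncr (S : Finset V) (w : V) : ℝ :=
  (monoEdges G (insert w S) : ℝ) - monoEdges G S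

lemma monoEdges_eq_sum (S : Finset V) : (monoEdges G S : ℝ)
    = ∑ e ∈ G.edgeFinset, if ∀ u ∈ e, ∀ w ∈ e, (u ∈ S ↔ w ∈ S) then (1 : ℝ) else 0 := by
  rw [monoEdges, Finset.card_filter]
  push_cast
  rfl

lemma abs_monoIncr_le (S : Finset V) (w : V) : |monoIncr G S w| ≤ G.maxDegree := by
  rw [monoIncr, monoEdges_eq_sum, monoEdges_eq_sum, ← Finset.sum_sub_distrib]
  calc _ ≤ ∑ e ∈ G.edgeFinset, if w ∈ e then (1 : ℝ) else 0 := by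
        refine (Finset.abs_sum_le_sum_abs _ _).trans (Finset.sum_le_sum fun e _ => ?_)
        by_cases hw : w ∈ e
        · rw [if_pos hw]
          split_ifs <;> norm_num
        · simp only [mono_insert_iff hw, sub_self, abs_zero, if_neg hw, le_refl]
    _ = (G.degree w : ℝ) := by
        rw [← G.card_incidenceFinset_eq_degree, G.incidenceFinset_eq_filter, Finset.card_filter]
        push_cast
        rfl
    _ ≤ _ := by exact_mod_cast G.degree_le_maxDegree w

/-- Only edges at $w$ can change status when $w$ is added, and only edges at $x$ notice the spin of
$x$; no edge contains both. -/
lemma monoIncr_insert {x w : V} (hxw : x ≠ w) (hadj : ¬ G.Adj x w) (S : Finset V) :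
    monoIncr G (insert x S) w = monoIncr G S w := by
  rw [monoIncr, monoIncr, Finset.insert_comm w x]
  simp only [monoEdges_eq_sum]
  rw [← Finset.sum_sub_distrib, ← Finset.sum_sub_distrib]
  refine Finset.sum_congr rfl fun e he => ?_
  by_cases hx : x ∈ e
  · have hw : w ∉ e := fun hw => hadj (by
      have := (Sym2.mem_and_mem_iff hxw).1 ⟨hx, hw⟩
      rw [this] at he
      simpa using he)
    rw [Finset.insert_comm x w]
    simp only [mono_insert_iff hw, sub_self]
  · simp only [mono_insert_iff hx]

/-- The rate at which `w` is added to the plus set `S`. -/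
noncomputable def addRate (β : ℝ) (S : Finset V) (w : V) : ℝ := Real.exp (β * monoIncr G S w)

/-- The average of `F` after adding one plus vertex to `S`. -/
noncomputable def upAverage (β : ℝ) (S : Finset V) (F : Finset V → ℝ) : ℝ :=
  (∑ w ∈ Sᶜ, addRate G β S w * F (insert w S)) / ∑ w ∈ Sᶜ, addRate G β S w

lemma addRate_pos (β : ℝ) (S : Finset V) (w : V) : 0 < addRate G β S w := Real.exp_pos _

lemma abs_mul_monoIncr_le {Δ : ℕ} (hG : G.maxDegree ≤ Δ) {β : ℝ} (hβ : 0 ≤ β) (S : Finset V)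
    (w : V) : |β * monoIncr G S w| ≤ β * Δ := by
  rw [abs_mul, abs_of_nonneg hβ]
  exact mul_le_mul_of_nonneg_left
    ((abs_monoIncr_le G S w).trans (by exact_mod_cast hG)) hβ

lemma addRate_le {Δ : ℕ} (hG : G.maxDegree ≤ Δ) {β : ℝ} (hβ : 0 ≤ β) (S : Finset V) (w : V) :
    addRate G β S w ≤ Real.exp (β * Δ) :=
  Real.exp_le_exp.2 (abs_le.1 (abs_mul_monoIncr_le G hG hβ S w)).2

lemma le_addRate {Δ : ℕ} (hG : G.maxDegree ≤ Δ) {β : ℝ} (hβ : 0 ≤ β) (S : Finset V) (w : V) :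
    (Real.exp (β * Δ))⁻¹ ≤ addRate G β S w := by
  rw [← Real.exp_neg]
  exact Real.exp_le_exp.2 (abs_le.1 (abs_mul_monoIncr_le G hG hβ S w)).1

lemma exp_monoEdges_insert (β : ℝ) (S : Finset V) (w : V) :
    Real.exp (β * monoEdges G (insert w S))
      = Real.exp (β * monoEdges G S) * addRate G β S w := by
  rw [addRate, ← Real.exp_add, monoIncr]
  ring_nf

/-- The configurations containing `W`, which misses one plus vertex, are the `W ∪ {w}`. -/
lemma sum_config_ite {k : ℕ} {U W : Finset V} (hW : W.card + 1 = k) (hUW : U ⊆ W)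
    (g : Finset V → ℝ) :
    ∑ Y : Config V k U, (if Y.1.card = k ∧ W ⊆ Y.1 then g Y.1 else 0)
      = ∑ w ∈ Wᶜ, g (insert w W) := by
  rw [← Finset.sum_subtype (Finset.univ.filter fun S : Finset V => S.card = k ∧ U ⊆ S)
    (p := fun S => S.card = k ∧ U ⊆ S) (by simp)
    (fun S => if S.card = k ∧ W ⊆ S then g S else 0), ← Finset.sum_filter, Finset.filter_filter]
  have h2 : (Finset.univ.filter fun S : Finset V =>
      (S.card = k ∧ U ⊆ S) ∧ (S.card = k ∧ W ⊆ S)) = Wᶜ.image fun w => insert w W := by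
    ext S
    simp only [Finset.mem_filter, Finset.mem_univ, true_and, Finset.mem_image, Finset.mem_compl]
    constructor
    · rintro ⟨_, hS, hWS⟩
      have hc : (S \ W).card = 1 := by rw [Finset.card_sdiff_of_subset hWS]; omega
      obtain ⟨w, hw⟩ := Finset.card_eq_one.1 hc
      have hwS : w ∈ S \ W := hw ▸ Finset.mem_singleton_self w
      refine ⟨w, (Finset.mem_sdiff.1 hwS).2, ?_⟩
      rw [Finset.insert_eq, ← hw, Finset.sdiff_union_of_subset hWS]
    · rintro ⟨w, hw, rfl⟩
      have := Finset.card_insert_of_notMem hw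
      have hs := Finset.subset_insert w W
      exact ⟨⟨by omega, hUW.trans hs⟩, by omega, hs⟩
  rw [h2, Finset.sum_image]
  intro a ha b _ hab
  have : a ∈ insert b W := by
    have hab : insert a W = insert b W := hab
    exact hab ▸ Finset.mem_insert_self a W
  exact (Finset.mem_insert.1 this).resolve_right (by simpa using ha)

lemma partitionFn_eq (β : ℝ) {k : ℕ} {W : Finset V} (hW : W.card + 1 = k) :
    partitionFn G β k W = Real.exp (β * monoEdges G W) * ∑ w ∈ Wᶜ, addRate G β W w := by
  rw [Finset.mul_sum, ← Finset.sum_congr rfl fun w _ => exp_monoEdges_insert G β W w,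
    ← sum_config_ite hW subset_rfl (fun S => Real.exp (β * monoEdges G S))]
  exact Finset.sum_congr rfl fun Y _ => (if_pos Y.2).symm

/-- The factor $e^{\beta m_G(W)}$ cancels from the Gibbs weights, so the up step depends only on the
local rates. -/
lemma sum_gibbs_mul (β : ℝ) {k : ℕ} {U W : Finset V} (hW : W.card + 1 = k) (hUW : U ⊆ W)
    (F : Finset V → ℝ) : ∑ Y : Config V k U, gibbs G β k W Y.1 * F Y.1 = upAverage G β W F := by
  simp only [gibbs, ite_mul, zero_mul]
  rw [sum_config_ite hW hUW (fun S => Real.exp (β * monoEdges G S) / partitionFn G β k W * F S),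
    upAverage, partitionFn_eq G β hW, Finset.sum_div]
  refine Finset.sum_congr rfl fun w _ => ?_
  rw [exp_monoEdges_insert, mul_div_mul_left _ _ (Real.exp_pos _).ne', div_mul_eq_mul_div]

lemma sum_addRate_pos (β : ℝ) {W : Finset V} (hW : W.card < Fintype.card V) :
    0 < ∑ w ∈ Wᶜ, addRate G β W w := by
  refine Finset.sum_pos (fun w _ => addRate_pos G β W w) (Finset.card_pos.1 ?_)
  rw [Finset.card_compl]
  omega

lemma upAverage_one (β : ℝ) {W : Finset V} (hW : W.card < Fintype.card V) :
    upAverage G β W (fun _ => 1) = 1 := by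
  simp only [upAverage, mul_one]
  exact div_self (sum_addRate_pos G β hW).ne'

/-- The averages of a swap-Lipschitz function over neighbouring plus sets are close. -/
lemma abs_upAverage_sub_le {Δ : ℕ} (hG : G.maxDegree ≤ Δ) {β : ℝ} (hβ : 0 ≤ β) {k : ℕ}
    (hk : (k : ℝ) ≤ (Fintype.card V : ℝ) / 2) {U B : Finset V} (hB : B.card + 2 = k) (hUB : U ⊆ B)
    {x y : V} (hx : x ∉ B) (hy : y ∉ B) (hxy : x ≠ y) {F : Finset V → ℝ} {L : ℝ} (hL : 0 ≤ L)
    (hF : ∀ (A : Finset V) (x y : V), U ⊆ A → A.card + 1 = k → x ∉ A → y ∉ A → x ≠ y →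
      |F (insert x A) - F (insert y A)| ≤ L) :
    |upAverage G β (insert x B) F - upAverage G β (insert y B) F|
      ≤ (1 + 2 * (4 * Δ + 1) * Real.exp (β * Δ) ^ 2 / Fintype.card V) * L := by
  set M := Real.exp (β * Δ) with hMdef
  have hM0 : 0 < M := Real.exp_pos _
  -- `T` holds the candidates common to both up steps. The remaining candidates, $y$ for one and $x$
  -- for the other, both lead to $B\cup\{x,y\}$, whose value plays the role of $c$.
  set T := (insert x (insert y B))ᶜ with hT
  have hmem : ∀ w, w ∈ T ↔ w ≠ x ∧ w ≠ y ∧ w ∉ B := fun w => by simp [hT]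
  have hxT : x ∉ T := fun h => ((hmem x).1 h).1 rfl
  have hyT : y ∉ T := fun h => ((hmem y).1 h).2.1 rfl
  have hTx : (insert x B)ᶜ = insert y T := by
    ext w
    simp only [Finset.mem_compl, Finset.mem_insert, hmem]
    by_cases h : w = y
    · subst h; simp [hxy.symm, hy]
    · simp [h]
  have hTy : (insert y B)ᶜ = insert x T := by
    ext w
    simp only [Finset.mem_compl, Finset.mem_insert, hmem]
    by_cases h : w = x
    · subst h; simp [hxy, hx]
    · simp [h]
  have hcx : (insert x B).card + 1 = k := by rw [Finset.card_insert_of_notMem hx]; omega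
  have hcy : (insert y B).card + 1 = k := by rw [Finset.card_insert_of_notMem hy]; omega
  have hk2 : (2 : ℝ) ≤ k := by exact_mod_cast (show 2 ≤ k by omega)
  have hn : (0 : ℝ) < Fintype.card V := by linarith
  have hdiff : ∀ S S' w, |addRate G β S w - addRate G β S' w| ≤ M := fun S S' w => by
    have h1 := addRate_pos G β S w
    have h2 := addRate_pos G β S' w
    have h3 := addRate_le G hG hβ S w
    have h4 := addRate_le G hG hβ S' w
    rw [abs_le]
    constructor <;> linarith
  have hdeg : ∀ v, (G.neighborFinset v).card ≤ Δ := fun v =>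
    (G.card_neighborFinset_eq_degree v).le.trans ((G.degree_le_maxDegree v).trans hG)
  have hD : ∑ w ∈ T, |addRate G β (insert x B) w - addRate G β (insert y B) w| ≤ 2 * Δ * M := by
    calc _ ≤ ∑ w ∈ T, if w ∈ G.neighborFinset x ∪ G.neighborFinset y then M else 0 := by
          refine Finset.sum_le_sum fun w hw => ?_
          obtain ⟨h1, h2, -⟩ := (hmem w).1 hw
          split_ifs with h
          · exact hdiff _ _ _
          · simp only [Finset.mem_union, SimpleGraph.mem_neighborFinset, not_or] at h
            rw [addRate, addRate, monoIncr_insert G h1.symm h.1, monoIncr_insert G h2.symm h.2,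
              sub_self, abs_zero]
      _ ≤ ∑ w, if w ∈ G.neighborFinset x ∪ G.neighborFinset y then M else 0 :=
          Finset.sum_le_univ_sum_of_nonneg fun w => by split_ifs <;> positivity
      _ = (G.neighborFinset x ∪ G.neighborFinset y).card * M := by
          rw [Finset.sum_ite_mem, Finset.univ_inter, Finset.sum_const, nsmul_eq_mul]
      _ ≤ 2 * Δ * M := by
          have : (G.neighborFinset x ∪ G.neighborFinset y).card ≤ 2 * Δ :=
            (Finset.card_union_le _ _).trans (by linarith [hdeg x, hdeg y])
          gcongr
          exact_mod_cast this
  -- As $k\le n/2$, at least $n/2$ vertices can be added, each at rate at least $M^{-1}$.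
  have hz : (Fintype.card V : ℝ) / 2 * M⁻¹
      ≤ ∑ w ∈ T, addRate G β (insert x B) w + addRate G β (insert x B) y := by
    rw [add_comm, ← Finset.sum_insert hyT, ← hTx]
    calc (Fintype.card V : ℝ) / 2 * M⁻¹ ≤ ((insert x B)ᶜ.card : ℝ) * M⁻¹ := by
          gcongr
          rw [Finset.card_compl, Nat.cast_sub (Finset.card_le_univ _)]
          have : ((insert x B).card : ℝ) + 1 = k := by exact_mod_cast hcx
          linarith
      _ = ∑ w ∈ (insert x B)ᶜ, M⁻¹ := by rw [Finset.sum_const, nsmul_eq_mul]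
      _ ≤ _ := Finset.sum_le_sum fun w _ => le_addRate G hG hβ _ w
  have hmain := abs_average_sub_average_le T
    (g := fun w => F (insert w (insert x B))) (g' := fun w => F (insert w (insert y B)))
    (c := F (insert y (insert x B))) (b' := addRate G β (insert y B) x)
    (fun w _ => (addRate_pos G β (insert x B) w).le)
    (fun w _ => (addRate_pos G β (insert y B) w).le)
    (addRate_pos G β (insert x B) y).le (addRate_pos G β (insert y B) x) hL
    (fun w hw => by
      obtain ⟨h1, h2, h3⟩ := (hmem w).1 hw
      rw [Finset.insert_comm w x, Finset.insert_comm w y]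
      exact hF _ x y (hUB.trans (Finset.subset_insert _ _))
        (by rw [Finset.card_insert_of_notMem h3]; omega) (by simp [h1.symm, hx])
        (by simp [h2.symm, hy]) hxy)
    (fun w hw => by
      obtain ⟨h1, h2, h3⟩ := (hmem w).1 hw
      rw [Finset.insert_comm y x]
      exact hF _ w x (hUB.trans (Finset.subset_insert _ _)) hcy (by simp [h2, h3])
        (by simp [hxy, hx]) h1)
    hD (M := M) (by
      have h1 := addRate_pos G β (insert x B) y
      have h2 := addRate_pos G β (insert y B) x
      have h3 := addRate_le G hG hβ (insert x B) y
      have h4 := addRate_le G hG hβ (insert y B) x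
      rw [abs_le]
      constructor <;> linarith)
    (by positivity) hz
  have hcomm : F (insert y (insert x B)) = F (insert x (insert y B)) := by
    rw [Finset.insert_comm]
  have e1 : upAverage G β (insert x B) F
      = (∑ w ∈ T, addRate G β (insert x B) w * F (insert w (insert x B))
        + addRate G β (insert x B) y * F (insert y (insert x B)))
        / (∑ w ∈ T, addRate G β (insert x B) w + addRate G β (insert x B) y) := by
    rw [upAverage, hTx, Finset.sum_insert hyT, Finset.sum_insert hyT, add_comm,
      add_comm (addRate G β (insert x B) y)]
  have e2 : upAverage G β (insert y B) F
      = (∑ w ∈ T, addRate G β (insert y B) w * F (insert w (insert y B))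
        + addRate G β (insert y B) x * F (insert y (insert x B)))
        / (∑ w ∈ T, addRate G β (insert y B) w + addRate G β (insert y B) x) := by
    rw [upAverage, hTy, Finset.sum_insert hxT, Finset.sum_insert hxT, add_comm,
      add_comm (addRate G β (insert y B) x), hcomm]
  rw [e1, e2]
  refine hmain.trans_eq ?_
  -- With $D=2\Delta M$ and $z=n/(2M)$, $(2D+M)/z=2(4\Delta+1)M^2/n$.
  congr 2
  field_simp
  ring

/-! ### Swap graph, reversibility and contraction of the walk -/

/-- Two configurations differing by moving one unpinned plus spin. -/
def SwapAdj {k : ℕ} {U : Finset V} (X Y : Config V k U) : Prop :=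
  ∃ (A : Finset V) (x y : V), U ⊆ A ∧ A.card + 1 = k ∧ x ∉ A ∧ y ∉ A ∧ x ≠ y ∧
    X.1 = insert x A ∧ Y.1 = insert y A

/-- Connectedness of the swap graph: exchanging some $x\in X\setminus Y$ for some $y\in Y\setminus
X$ shrinks $X\setminus Y$, and $x\notin U$ because $U\subseteq Y$. -/
lemma eq_of_forall_swapAdj {k : ℕ} {U : Finset V} (f : Config V k U → ℝ)
    (hf : ∀ X Y, SwapAdj X Y → f X = f Y) (X Y : Config V k U) : f X = f Y := by
  induction hm : (X.1 \ Y.1).card generalizing X with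
  | zero =>
    have hs : X.1 ⊆ Y.1 := Finset.sdiff_eq_empty_iff_subset.1 (Finset.card_eq_zero.1 hm)
    rw [Subtype.ext (Finset.eq_of_subset_of_card_le hs (by rw [X.2.1, Y.2.1]))]
  | succ m ih =>
    obtain ⟨x, hx⟩ := Finset.card_pos.1 (show 0 < (X.1 \ Y.1).card by omega)
    have hc : (Y.1 \ X.1).card = (X.1 \ Y.1).card :=
      Finset.card_sdiff_comm (by rw [X.2.1, Y.2.1])
    obtain ⟨y, hy⟩ := Finset.card_pos.1 (show 0 < (Y.1 \ X.1).card by omega)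
    rw [Finset.mem_sdiff] at hx hy
    have hyx : y ∉ X.1.erase x := fun h => hy.2 (Finset.mem_of_mem_erase h)
    have hU : U ⊆ X.1.erase x := fun u hu =>
      Finset.mem_erase.2 ⟨fun h => hx.2 (h ▸ Y.2.2 hu), X.2.2 hu⟩
    have hcard : (X.1.erase x).card + 1 = k := by
      rw [Finset.card_erase_add_one hx.1, X.2.1]
    let X' : Config V k U := ⟨insert y (X.1.erase x),
      by rw [Finset.card_insert_of_notMem hyx, hcard], hU.trans (Finset.subset_insert _ _)⟩
    have hadj : SwapAdj X X' := ⟨X.1.erase x, x, y, hU, hcard, Finset.notMem_erase _ _, hyx,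
      fun h => hy.2 (h ▸ hx.1), (Finset.insert_erase hx.1).symm, rfl⟩
    rw [hf X X' hadj]
    refine ih X' ?_
    have : X'.1 \ Y.1 = (X.1 \ Y.1).erase x := by
      ext z
      simp only [X', Finset.mem_sdiff, Finset.mem_insert, Finset.mem_erase]
      constructor
      · rintro ⟨rfl | h, h2⟩
        · exact absurd hy.1 h2
        · exact ⟨h.1, h.2, h2⟩
      · rintro ⟨h1, h2, h3⟩
        exact ⟨Or.inr ⟨h1, h2⟩, h3⟩
    rw [this, Finset.card_erase_of_mem (Finset.mem_sdiff.2 hx), hm]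
    rfl

lemma card_sdiff_cast {k : ℕ} {U : Finset V} (X : Config V k U) :
    ((X.1 \ U).card : ℝ) = (k : ℝ) - U.card := by
  rw [Finset.card_sdiff_of_subset X.2.2, Nat.cast_sub (Finset.card_le_card X.2.2), X.2.1]

lemma downUpWalk_apply_sum (β : ℝ) {k : ℕ} {U : Finset V} (X : Config V k U) (F : Finset V → ℝ) :
    ∑ Y, downUpWalk G β k U X Y * F Y.1
      = 1 / ((k : ℝ) - U.card) * ∑ v ∈ X.1 \ U, upAverage G β (X.1.erase v) F := by
  simp only [downUpWalk, Finset.sum_mul]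
  rw [Finset.sum_comm, Finset.mul_sum]
  refine Finset.sum_congr rfl fun v hv => ?_
  rw [Finset.mem_sdiff] at hv
  rw [← sum_gibbs_mul G β (k := k) (by rw [Finset.card_erase_add_one hv.1, X.2.1])
    (Finset.subset_erase.2 ⟨X.2.2, hv.2⟩), Finset.mul_sum,
    card_sdiff_cast]
  exact Finset.sum_congr rfl fun Y _ => mul_assoc _ _ _

lemma downUpWalk_row_sum (β : ℝ) {k : ℕ} {U : Finset V} (hU : U.card < k)
    (hk : k ≤ Fintype.card V) (X : Config V k U) : ∑ Y, downUpWalk G β k U X Y = 1 := by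
  have h := downUpWalk_apply_sum G β X (fun _ => 1)
  simp only [mul_one] at h
  have hr : (0 : ℝ) < (k : ℝ) - U.card := sub_pos.2 (by exact_mod_cast hU)
  rw [h, Finset.sum_congr rfl fun v hv => upAverage_one G β ?_, Finset.sum_const, nsmul_eq_mul,
    card_sdiff_cast, mul_one, one_div, inv_mul_cancel₀ hr.ne']
  have := Finset.card_erase_add_one (Finset.mem_sdiff.1 hv).1
  rw [X.2.1] at this
  omega

lemma sum_sdiff_erase {k : ℕ} {U : Finset V} (X : Config V k U) (h : Finset V → ℝ) :
    ∑ v ∈ X.1 \ U, h (X.1.erase v)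
      = ∑ W : Finset V, if W.card + 1 = k ∧ U ⊆ W ∧ W ⊆ X.1 then h W else 0 := by
  have himg : (Finset.univ.filter fun W : Finset V => W.card + 1 = k ∧ U ⊆ W ∧ W ⊆ X.1)
      = (X.1 \ U).image fun v => X.1.erase v := by
    ext W
    simp only [Finset.mem_filter, Finset.mem_univ, true_and, Finset.mem_image]
    constructor
    · rintro ⟨hW, hUW, hWX⟩
      have hc : (X.1 \ W).card = 1 := by rw [Finset.card_sdiff_of_subset hWX, X.2.1]; omega
      obtain ⟨v, hv⟩ := Finset.card_eq_one.1 hc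
      have hvX := Finset.mem_sdiff.1 (hv ▸ Finset.mem_singleton_self v : v ∈ X.1 \ W)
      refine ⟨v, Finset.mem_sdiff.2 ⟨hvX.1, fun h => hvX.2 (hUW h)⟩, ?_⟩
      rw [Finset.erase_eq, ← hv, Finset.sdiff_sdiff_eq_self hWX]
    · rintro ⟨v, hv, rfl⟩
      rw [Finset.mem_sdiff] at hv
      exact ⟨by rw [Finset.card_erase_add_one hv.1, X.2.1],
        Finset.subset_erase.2 ⟨X.2.2, hv.2⟩,
        Finset.erase_subset _ _⟩
  rw [← Finset.sum_filter, himg, Finset.sum_image]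
  intro a ha b _ hab
  by_contra hne
  have ha := (Finset.mem_sdiff.1 (Finset.mem_coe.1 ha)).1
  have hab : X.1.erase a = X.1.erase b := hab
  have : a ∈ X.1.erase b := Finset.mem_erase.2 ⟨hne, ha⟩
  rw [← hab] at this
  exact Finset.notMem_erase a X.1 this

/-- Summing over the intermediate set $W\subseteq X\cap Y$ makes the flow visibly symmetric, since
the removal probability $1/(k-|U|)$ does not depend on the state. -/
lemma downUpWalk_reversible (β : ℝ) {k : ℕ} {U : Finset V} (X Y : Config V k U) :
    gibbs G β k U X.1 * downUpWalk G β k U X Y = gibbs G β k U Y.1 * downUpWalk G β k U Y X := by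
  have h : ∀ X Y : Config V k U, gibbs G β k U X.1 * downUpWalk G β k U X Y
      = ∑ W : Finset V, if W.card + 1 = k ∧ U ⊆ W ∧ W ⊆ X.1 ∧ W ⊆ Y.1 then
        Real.exp (β * monoEdges G X.1) * Real.exp (β * monoEdges G Y.1)
          / (partitionFn G β k U * ((k : ℝ) - U.card) * partitionFn G β k W) else 0 := by
    intro X Y
    rw [downUpWalk, sum_sdiff_erase X (fun W => 1 / ((X.1 \ U).card : ℝ) * gibbs G β k W Y.1),
      Finset.mul_sum]
    refine Finset.sum_congr rfl fun W _ => ?_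
    rw [gibbs, if_pos X.2, gibbs, card_sdiff_cast]
    by_cases h1 : W ⊆ Y.1
    · simp only [h1, Y.2.1, and_true, if_true, mul_ite, mul_zero]
      refine if_congr Iff.rfl ?_ rfl
      simp only [div_eq_mul_inv, mul_inv]
      ring
    · simp [h1]
  rw [h, h]
  refine Finset.sum_congr rfl fun W _ => if_congr (by tauto) ?_ rfl
  rw [mul_comm (Real.exp _)]

lemma partitionFn_pos (β : ℝ) {k : ℕ} {U : Finset V} [Nonempty (Config V k U)] :
    0 < partitionFn G β k U :=
  Finset.sum_pos (fun _ _ => Real.exp_pos _) Finset.univ_nonempty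

lemma gibbs_pos (β : ℝ) {k : ℕ} {U : Finset V} (X : Config V k U) : 0 < gibbs G β k U X.1 := by
  have : Nonempty (Config V k U) := ⟨X⟩
  rw [gibbs, if_pos X.2]
  exact div_pos (Real.exp_pos _) (partitionFn_pos G β)

lemma sum_gibbs (β : ℝ) {k : ℕ} {U : Finset V} [Nonempty (Config V k U)] :
    ∑ X : Config V k U, gibbs G β k U X.1 = 1 := by
  have h : ∀ X : Config V k U, gibbs G β k U X.1
      = Real.exp (β * monoEdges G X.1) / partitionFn G β k U := fun X => if_pos X.2
  simp only [h]
  rw [← Finset.sum_div]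
  exact div_self (partitionFn_pos G β).ne'

lemma nontrivial_config {k : ℕ} {U : Finset V} (hU : U.card < k) (hk : k < Fintype.card V) :
    Nontrivial (Config V k U) := by
  obtain ⟨A, hUA, -, hA⟩ := Finset.exists_subsuperset_card_eq (Finset.subset_univ U)
    (show U.card ≤ k - 1 by omega) (by rw [Finset.card_univ]; omega)
  have hc : 1 < Aᶜ.card := by rw [Finset.card_compl]; omega
  obtain ⟨x, hx, y, hy, hxy⟩ := Finset.one_lt_card.1 hc
  rw [Finset.mem_compl] at hx hy
  refine ⟨⟨insert x A, by rw [Finset.card_insert_of_notMem hx]; omega,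
    hUA.trans (Finset.subset_insert _ _)⟩, ⟨insert y A,
    by rw [Finset.card_insert_of_notMem hy]; omega, hUA.trans (Finset.subset_insert _ _)⟩, ?_⟩
  intro h
  have : x ∈ insert y A := by
    have h : insert x A = insert y A := Subtype.ext_iff.1 h
    exact h ▸ Finset.mem_insert_self x A
  exact (Finset.mem_insert.1 this).elim hxy hx

/-- The walk contracts the swap-Lipschitz seminorm when few plus spins are unpinned. -/
lemma downUpWalk_contraction {Δ : ℕ} (hG : G.maxDegree ≤ Δ) {β : ℝ} (hβ : 0 ≤ β) {k : ℕ}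
    {U : Finset V} (hk : (k : ℝ) ≤ (Fintype.card V : ℝ) / 2) (hU : U.card < k)
    (hr : 2 * (2 * (4 * Δ + 1) * Real.exp (β * Δ) ^ 2) * ((k : ℝ) - U.card) ≤ Fintype.card V)
    (f : Config V k U → ℝ) (L : ℝ) (hf : ∀ X Y, SwapAdj X Y → |f X - f Y| ≤ L)
    (X Y : Config V k U) (hXY : SwapAdj X Y) :
    |∑ Z, downUpWalk G β k U X Z * f Z - ∑ Z, downUpWalk G β k U Y Z * f Z|
      ≤ (1 - 1 / (2 * ((k : ℝ) - U.card))) * L := by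
  set C : ℝ := 2 * (4 * Δ + 1) * Real.exp (β * Δ) ^ 2 with hC
  set r : ℝ := (k : ℝ) - U.card with hrdef
  have hC0 : 0 < C := by positivity
  have hr0 : 0 < r := sub_pos.2 (by exact_mod_cast hU)
  have hn : (0 : ℝ) < Fintype.card V := lt_of_lt_of_le (by positivity) hr
  have hL : 0 ≤ L := (abs_nonneg _).trans (hf X Y hXY)
  -- The default value $0$ is harmless: the averages below evaluate `F` only at valid
  -- configurations.
  let F : Finset V → ℝ := fun S => if h : S.card = k ∧ U ⊆ S then f ⟨S, h⟩ else 0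
  have hfF : ∀ Z : Config V k U, f Z = F Z.1 := fun Z => by simp only [F, dif_pos Z.2]
  have hF : ∀ (A : Finset V) (x y : V), U ⊆ A → A.card + 1 = k → x ∉ A → y ∉ A → x ≠ y →
      |F (insert x A) - F (insert y A)| ≤ L := by
    intro A x y hUA hA hx hy hxy
    have h1 : (insert x A).card = k ∧ U ⊆ insert x A :=
      ⟨by rw [Finset.card_insert_of_notMem hx, hA], hUA.trans (Finset.subset_insert _ _)⟩
    have h2 : (insert y A).card = k ∧ U ⊆ insert y A :=
      ⟨by rw [Finset.card_insert_of_notMem hy, hA], hUA.trans (Finset.subset_insert _ _)⟩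
    have := hf ⟨_, h1⟩ ⟨_, h2⟩ ⟨A, x, y, hUA, hA, hx, hy, hxy, rfl, rfl⟩
    rwa [hfF, hfF] at this
  simp only [hfF]
  rw [downUpWalk_apply_sum, downUpWalk_apply_sum, ← hrdef]
  obtain ⟨A, x, y, hUA, hA, hx, hy, hxy, hX, hY⟩ := hXY
  -- Removing $z$ itself gives the term at $A$, which cancels between the two states and leaves
  -- $r-1$ terms.
  have hsplit : ∀ z, z ∉ A → ∑ v ∈ insert z A \ U, upAverage G β ((insert z A).erase v) F
      = upAverage G β A F + ∑ v ∈ A \ U, upAverage G β (insert z (A.erase v)) F := by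
    intro z hz
    rw [Finset.insert_sdiff_of_notMem _ (fun h => hz (hUA h)),
      Finset.sum_insert (fun h => hz (Finset.mem_sdiff.1 h).1), Finset.erase_insert hz]
    congr 1
    refine Finset.sum_congr rfl fun v hv => ?_
    rw [Finset.erase_insert_of_ne]
    rintro rfl
    exact hz (Finset.mem_sdiff.1 hv).1
  rw [hX, hY, hsplit x hx, hsplit y hy, ← mul_sub, add_sub_add_left_eq_sub,
    ← Finset.sum_sub_distrib, abs_mul, abs_of_pos (by positivity)]
  have hcard : ((A \ U).card : ℝ) = r - 1 := by
    rw [Finset.card_sdiff_of_subset hUA, Nat.cast_sub (Finset.card_le_card hUA), hrdef]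
    have : (A.card : ℝ) + 1 = k := by exact_mod_cast hA
    linarith
  calc _ ≤ 1 / r * ∑ v ∈ A \ U, (1 + C / Fintype.card V) * L := by
        gcongr
        refine (Finset.abs_sum_le_sum_abs _ _).trans (Finset.sum_le_sum fun v hv => ?_)
        rw [Finset.mem_sdiff] at hv
        have hcv := Finset.card_erase_add_one hv.1
        exact abs_upAverage_sub_le G hG hβ hk (by omega)
          (Finset.subset_erase.2 ⟨hUA, hv.2⟩)
          (fun h => hx (Finset.mem_of_mem_erase h)) (fun h => hy (Finset.mem_of_mem_erase h))
          hxy hL hF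
    _ = (1 / r * (r - 1) * (1 + C / Fintype.card V)) * L := by
        rw [Finset.sum_const, nsmul_eq_mul, hcard]; ring
    _ ≤ _ := by
        refine mul_le_mul_of_nonneg_right ?_ hL
        -- With $t=1/(2r)$ and $u=C/n\le t$, $(1-2t)(1+u)\le 1-2t+u\le 1-t$.
        have h1 : C / Fintype.card V ≤ 1 / (2 * r) := by
          rw [div_le_div_iff₀ hn (by positivity)]
          linarith
        have h2 : 1 / r * (r - 1) = 1 - 2 * (1 / (2 * r)) := by field_simp
        have h3 : 0 ≤ C / Fintype.card V := by positivity
        rw [h2]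
        have h4 : 0 ≤ 1 / (2 * r) := by positivity
        nlinarith [mul_nonneg h4 h3]

end Walk

end FixedMagIsing

/-! ### Choice of constants -/

theorem mainTheorem7 (Δ : ℕ) (hΔ : 3 ≤ Δ) (β : ℝ) (hβ : 0 ≤ β) :
    ∃ α : ℝ, 0 < α ∧ ∃ c : ℝ, 0 < c ∧
      ∀ (V : Type*) [Fintype V] [DecidableEq V] (G : SimpleGraph V) [DecidableRel G.Adj],
        G.maxDegree ≤ Δ →
        ∀ (k : ℕ) (U : Finset V),
          0 < k → (k : ℝ) ≤ (Fintype.card V : ℝ) / 2 →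
          U.card < k → (k : ℝ) - (U.card : ℝ) ≤ α * (Fintype.card V : ℝ) →
          c / (k : ℝ) ≤
            FixedMagIsing.spectralGap (FixedMagIsing.downUpWalk G β k U)
              (fun S => FixedMagIsing.gibbs G β k U S.1) := by
  -- This is twice the constant of `abs_upAverage_sub_le`, so $\alpha=1/C$ lets the expansion use up
  -- at most half of the $1/r$ gain. The value $c=1/2$ then comes from $k-|U|\le k$.
  set C : ℝ := 2 * (2 * (4 * Δ + 1) * Real.exp (β * Δ) ^ 2) with hC
  have hC0 : 0 < C := by positivity
  refine ⟨1 / C, by positivity, 1 / 2, by norm_num, ?_⟩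
  intro V _ _ G _ hG k U hk0 hk hU hr
  have hk0' : (0 : ℝ) < k := by exact_mod_cast hk0
  have hkn : k < Fintype.card V := by
    have : (k : ℝ) < Fintype.card V := by linarith
    exact_mod_cast this
  have hr0 : (0 : ℝ) < (k : ℝ) - U.card := sub_pos.2 (by exact_mod_cast hU)
  have := FixedMagIsing.nontrivial_config hU hkn
  have hr' : C * ((k : ℝ) - U.card) ≤ Fintype.card V := by
    calc C * ((k : ℝ) - U.card) ≤ C * (1 / C * Fintype.card V) := by gcongr
      _ = Fintype.card V := by field_simp
  calc (1 / 2 : ℝ) / k ≤ 1 / (2 * ((k : ℝ) - U.card)) := by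
        rw [div_div]
        gcongr
        linarith [(Nat.cast_nonneg U.card : (0 : ℝ) ≤ U.card)]
    _ ≤ _ := FixedMagIsing.le_spectralGap (fun X => FixedMagIsing.gibbs_pos G β X)
        (FixedMagIsing.poincare_of_contraction (fun X => FixedMagIsing.gibbs_pos G β X)
          (FixedMagIsing.sum_gibbs G β) (FixedMagIsing.downUpWalk_row_sum G β hU hkn.le)
          (FixedMagIsing.downUpWalk_reversible G β) FixedMagIsing.eq_of_forall_swapAdj
          (FixedMagIsing.downUpWalk_contraction G hG hβ hk hU hr'))
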